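/- Let $H$ be a finite abelian group of odd order, and let $S \subseteq H$ be a subset with $1_H \notin S$ and $x^{-1} \in S$ for every $x \in S$. Let $\mathrm{Cay}(H,S)$ be the graph with vertex set $H$ and edges $\{x, sx\}$ for $x \in H$ and $s \in S$. For a graph $\Gamma$, let $\Gamma \times K_2$ denote its canonical double cover, that is, the graph with vertex set $V(\Gamma) \times \{0,1\}$ and edges $\{(u,0),(v,1)\}$, where $u, v$ are adjacent in $\Gamma$. Call $\Gamma$ stable if $\mathrm{Aut}(\Gamma \times K_2) \cong \mathrm{Aut}(\Gamma) \times \mathbb{Z}_2$, and unstable otherwise. If $\mathrm{Cay}(H,S)$ is connected and unstable, then it has twins, i.e. there are two distinct vertices of $\mathrm{Cay}(H,S)$ with the same neighbourhood. -/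

import Mathlib

namespace SimpleGraph

/-- A graph is stable if the automorphism group of its canonical double cover `G × K₂`
is isomorphic, as a group, to `Aut(G) × ℤ₂`. The canonical double cover is Mathlib's
`bipartiteDoubleCover`, whose vertex set is two disjoint copies of `V` and whose edges join
`u` in one copy to `v` in the other copy exactly when `u` and `v` are adjacent in `G`. -/
def IsStable {V : Type*} (G : SimpleGraph V) : Prop :=
  Nonempty ((G.bipartiteDoubleCover ≃g G.bipartiteDoubleCover) ≃*
    (G ≃g G) × Multiplicative (ZMod 2))

/-- A graph is unstable if it is not stable. -/
def IsUnstable {V : Type*} (G : SimpleGraph V) : Prop :=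
  ¬ G.IsStable

/-- A graph has twins if two distinct vertices have the same neighbourhood. -/
def HasTwins {V : Type*} (G : SimpleGraph V) : Prop :=
  ∃ u v : V, u ≠ v ∧ G.neighborSet u = G.neighborSet v

end SimpleGraph

/-!
Let `A` be the adjacency matrix of the Cayley graph over `𝔽₂`, and `n` the order of the group.
Since `A` is the matrix of multiplication by an element of the commutative ring `𝔽₂[H]`, on which
the `φ(n)`-fold iterate of the Frobenius is the identity because `2 ^ φ(n) ≡ 1 [MOD n]`, we have
`A ^ (2 ^ φ(n)) = A`. Thus an even power of the adjacency matrix `[[0, A], [A, 0]]` of the double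
cover is `[[A, 0], [0, A]]`, and every automorphism of the double cover is also an automorphism of
the disjoint union of two copies of the graph. By connectedness it permutes the two copies, so up
to exchanging them it is given by an automorphism `α` of one copy and an automorphism `β` of the
other; `α y` and `β y` have the same neighbours, hence agree when there are no twins.
-/

section DirectProduct

open Multiplicative in
theorem nonempty_mulEquiv_prod_zmod_two {K P : Type*} [Group K] [Group P] {f : K →* P}
    (hf : Function.Injective f) {t : P} (hsq : t * t = 1) (hcomm : ∀ k, Commute (f k) t)
    (ht : t ∉ f.range) (hcover : ∀ x, x ∈ f.range ∨ t * x ∈ f.range) :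
    Nonempty (P ≃* K × Multiplicative (ZMod 2)) := by
  have zmod_two : ∀ e : Multiplicative (ZMod 2), e = 1 ∨ e = ofAdd 1 := by decide
  let g : Multiplicative (ZMod 2) →* P := MonoidHom.mk' (fun e ↦ t ^ e.toAdd.val) fun a b ↦ by
    rcases zmod_two a with rfl | rfl <;> rcases zmod_two b with rfl | rfl <;>
      simp [hsq, ← ofAdd_add, CharTwo.add_self_eq_zero, ZMod.val_one]
  have hg : g (ofAdd 1) = t := pow_one t
  have hfg : ∀ k e, Commute (f k) (g e) := fun k e ↦ (hcomm k).pow_right _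
  refine ⟨(MulEquiv.ofBijective (f.noncommCoprod g hfg) ⟨?_, fun x ↦ ?_⟩).symm⟩
  · rw [injective_iff_map_eq_one]
    rintro ⟨k, e⟩ h
    rw [MonoidHom.noncommCoprod_apply] at h
    rcases zmod_two e with rfl | rfl
    · rw [map_one, mul_one] at h
      exact Prod.ext ((map_eq_one_iff f hf).1 h) rfl
    · refine absurd ⟨k⁻¹, ?_⟩ ht
      rw [map_inv, inv_eq_of_mul_eq_one_right h, hg]
  · rcases hcover x with ⟨k, hk⟩ | ⟨k, hk⟩
    · exact ⟨(k, 1), by simp [hk]⟩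
    · refine ⟨(k, ofAdd 1), ?_⟩
      rw [MonoidHom.noncommCoprod_apply, hg, (hcomm k).eq, hk, ← mul_assoc, hsq, one_mul]

end DirectProduct

open SimpleGraph

section DoubleCover

variable {V W : Type*} {G : SimpleGraph V} {K : SimpleGraph W}

variable (G) in
/-- The embedding of `Aut(G)` into the automorphism group of the canonical double cover of `G`,
an automorphism of `G` acting in the same way on both copies of the vertex set. -/
def doubleCoverLift : (G ≃g G) →* (G.bipartiteDoubleCover ≃g G.bipartiteDoubleCover) where
  toFun a :=
    { toEquiv := Equiv.sumCongr a.toEquiv a.toEquiv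
      map_rel_iff' := by rintro (u | u) (v | v) <;> simp [a.map_adj_iff] }
  map_one' := by ext (x | x) <;> rfl
  map_mul' _ _ := by ext (x | x) <;> rfl

variable (G) in
/-- The automorphism of the canonical double cover of `G` exchanging the two copies of the vertex
set. It generates the factor `ℤ₂` in the definition of stability. -/
def doubleCoverSwap : G.bipartiteDoubleCover ≃g G.bipartiteDoubleCover where
  toEquiv := Equiv.sumComm V V
  map_rel_iff' := by rintro (u | u) (v | v) <;> simp

theorem doubleCoverLift_injective : Function.Injective (doubleCoverLift G) := fun _ _ h ↦
  RelIso.ext fun x ↦ Sum.inl_injective (DFunLike.congr_fun h (.inl x))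

theorem doubleCoverSwap_mul_self : doubleCoverSwap G * doubleCoverSwap G = 1 :=
  RelIso.ext Sum.swap_swap

theorem commute_doubleCoverLift_doubleCoverSwap (a : G ≃g G) :
    Commute (doubleCoverLift G a) (doubleCoverSwap G) :=
  RelIso.ext <| by rintro (x | x) <;> rfl

theorem doubleCoverSwap_notMem_range_lift [Nonempty V] :
    doubleCoverSwap G ∉ (doubleCoverLift G).range := by
  rintro ⟨a, ha⟩
  inhabit V
  exact Sum.inl_ne_inr (DFunLike.congr_fun ha (.inl default))

theorem isStable_of_forall_mem_range_lift [Nonempty V]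
    (h : ∀ φ : G.bipartiteDoubleCover ≃g G.bipartiteDoubleCover,
      φ ∈ (doubleCoverLift G).range ∨ doubleCoverSwap G * φ ∈ (doubleCoverLift G).range) :
    G.IsStable :=
  nonempty_mulEquiv_prod_zmod_two doubleCoverLift_injective doubleCoverSwap_mul_self
    commute_doubleCoverLift_doubleCoverSwap doubleCoverSwap_notMem_range_lift h

theorem mem_range_inl_of_preconnected {W' : Type*} {K' : SimpleGraph W'} (hG : G.Preconnected)
    (f : G →g K ⊕g K') {x₀ : V} (hx₀ : f x₀ ∈ Set.range Sum.inl) (x : V) :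
    f x ∈ Set.range Sum.inl := by
  obtain ⟨y₀, hy₀⟩ := hx₀
  have hreach := (hG x₀ x).map f
  rcases hx : f x with y | y
  · exact ⟨y, rfl⟩
  · rw [← hy₀, hx] at hreach
    exact absurd hreach (not_reachable_sum_inl_inr y₀ y)

theorem eq_of_adj_iff_of_not_hasTwins (hK : ¬ K.HasTwins) (a : G ≃g K) {b : V → W}
    (h : ∀ x y, K.Adj (a x) (b y) ↔ G.Adj x y) : b = a := by
  funext y
  by_contra hne
  refine hK ⟨b y, a y, hne, Set.ext fun z ↦ ?_⟩
  obtain ⟨x, rfl⟩ := a.surjective z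
  rw [mem_neighborSet, mem_neighborSet, K.adj_comm, h, K.adj_comm, a.map_adj_iff]

theorem mem_range_lift_of_preserves_sum [Finite V] (hconn : G.Preconnected) (htwin : ¬ G.HasTwins)
    (φ : G.bipartiteDoubleCover ≃g G.bipartiteDoubleCover)
    (hφ : ∀ u v, (G ⊕g G).Adj (φ u) (φ v) ↔ (G ⊕g G).Adj u v)
    {x₀ : V} (hx₀ : φ (.inl x₀) ∈ Set.range Sum.inl) : φ ∈ (doubleCoverLift G).range := by
  have hinl : Set.MapsTo φ (Set.range Sum.inl) (Set.range Sum.inl) := by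
    let f : G →g G ⊕g G := ⟨fun x ↦ φ (.inl x), fun h ↦ (hφ _ _).2 (sum_adj_inl.2 h)⟩
    rintro _ ⟨x, rfl⟩
    exact mem_range_inl_of_preconnected hconn f hx₀ x
  obtain ⟨⟨α, β⟩, hαβ⟩ := Equiv.Perm.mem_sumCongrHom_range_of_perm_mapsTo_inl (σ := φ.toEquiv) hinl
  have hα : ∀ x, φ (.inl x) = .inl (α x) := fun x ↦ (DFunLike.congr_fun hαβ (.inl x)).symm
  have hβ : ∀ x, φ (.inr x) = .inr (β x) := fun x ↦ (DFunLike.congr_fun hαβ (.inr x)).symm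
  let a : G ≃g G := ⟨α, fun {x y} ↦ by rw [← sum_adj_inl, ← hα, ← hα, hφ, sum_adj_inl]⟩
  have hβa : ⇑β = a := eq_of_adj_iff_of_not_hasTwins htwin a fun x y ↦ by
    have hcross := φ.map_adj_iff (v := .inl x) (w := .inr y)
    rwa [hα, hβ] at hcross
  refine ⟨a, RelIso.ext ?_⟩
  rintro (x | x)
  · exact (hα x).symm
  · rw [hβ, hβa]
    rfl

theorem isStable_of_forall_preserves_sum [Finite V] (hconn : G.Connected) (htwin : ¬ G.HasTwins)
    (h : ∀ (φ : G.bipartiteDoubleCover ≃g G.bipartiteDoubleCover) (u v : V ⊕ V),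
      (G ⊕g G).Adj (φ u) (φ v) ↔ (G ⊕g G).Adj u v) :
    G.IsStable := by
  have := hconn.nonempty
  inhabit V
  refine isStable_of_forall_mem_range_lift fun φ ↦ ?_
  rcases hx : φ (.inl default) with y | y
  · exact .inl (mem_range_lift_of_preserves_sum hconn.preconnected htwin φ (h φ) ⟨y, hx.symm⟩)
  · refine .inr (mem_range_lift_of_preserves_sum hconn.preconnected htwin _ (h _)
      (x₀ := default) ⟨y, ?_⟩)
    rw [RelIso.mul_apply, hx]
    rfl

end DoubleCover

section AdjMatrix

variable {V : Type*} {G : SimpleGraph V} [DecidableRel G.Adj]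

theorem adjMatrix_sum {W : Type*} (R : Type*) [Zero R] [One R] (K : SimpleGraph W)
    [DecidableRel K.Adj] [DecidableRel (G ⊕g K).Adj] :
    (G ⊕g K).adjMatrix R = Matrix.fromBlocks (G.adjMatrix R) 0 0 (K.adjMatrix R) := by
  ext (i | i) (j | j) <;> simp [adjMatrix_apply]

variable [Fintype V] [DecidableEq V] {R : Type*} [Semiring R]

theorem adjMatrix_bipartiteDoubleCover_pow_two_mul (m : ℕ) :
    G.bipartiteDoubleCover.adjMatrix R ^ (2 * m) =
      Matrix.fromBlocks (G.adjMatrix R ^ (2 * m)) 0 0 (G.adjMatrix R ^ (2 * m)) := by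
  have hblocks : G.bipartiteDoubleCover.adjMatrix R =
      Matrix.fromBlocks 0 (G.adjMatrix R) (G.adjMatrix R) 0 := by
    ext (i | i) (j | j) <;> rfl
  have hsq : G.bipartiteDoubleCover.adjMatrix R ^ 2 =
      Matrix.fromBlocks (G.adjMatrix R ^ 2) 0 0 (G.adjMatrix R ^ 2) := by
    simp only [hblocks, sq, Matrix.fromBlocks_multiply, zero_mul, mul_zero, zero_add, add_zero]
  rw [pow_mul, pow_mul, hsq, Matrix.fromBlocks_diagonal_pow]

theorem adj_iff_of_adjMatrix_pow_eq [Nontrivial R] {K : SimpleGraph V} [DecidableRel K.Adj]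
    {n : ℕ} (h : G.adjMatrix R ^ n = K.adjMatrix R) (φ : G ≃g G) (u v : V) :
    K.Adj (φ u) (φ v) ↔ K.Adj u v := by
  have hfix : Matrix.reindexAlgEquiv ℕ R φ.symm.toEquiv (K.adjMatrix R) = K.adjMatrix R := by
    rw [← h, map_pow]
    exact congrArg (· ^ n) (φ.symm.reindex_adjMatrix R)
  have hentry : K.adjMatrix R (φ u) (φ v) = K.adjMatrix R u v := congrFun₂ hfix u v
  have hadj (x y : V) : K.adjMatrix R x y = 1 ↔ K.Adj x y := by simp [adjMatrix_apply]
  rw [← hadj, hentry, hadj]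

theorem isStable_of_adjMatrix_pow_two_mul_eq [Nontrivial R] {m : ℕ}
    (h : G.adjMatrix R ^ (2 * m) = G.adjMatrix R) (hconn : G.Connected)
    (htwin : ¬ G.HasTwins) : G.IsStable := by
  classical
  have hsum : G.bipartiteDoubleCover.adjMatrix R ^ (2 * m) = (G ⊕g G).adjMatrix R := by
    rw [adjMatrix_bipartiteDoubleCover_pow_two_mul, h, adjMatrix_sum]
  exact isStable_of_forall_preserves_sum hconn htwin (adj_iff_of_adjMatrix_pow_eq hsum)

end AdjMatrix

section Cayley

variable {H : Type*}

theorem monoidAlgebra_zmod_pow_eq_self [CommGroup H] {p : ℕ} [Fact p.Prime]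
    (hp : p.Coprime (Nat.card H)) (x : MonoidAlgebra (ZMod p) H) :
    x ^ p ^ (Nat.card H).totient = x := by
  have hpow (g : H) : g ^ p ^ (Nat.card H).totient = g := by
    simpa using pow_eq_pow_iff_modEq.2
      ((Nat.ModEq.pow_totient hp).of_dvd (orderOf_dvd_natCard g))
  have := charP_of_injective_algebraMap
    (FaithfulSMul.algebraMap_injective (ZMod p) (MonoidAlgebra (ZMod p) H)) p
  have hfrob : iterateFrobenius (MonoidAlgebra (ZMod p) H) p (Nat.card H).totient =
      RingHom.id _ := by
    refine MonoidAlgebra.ringHom_ext (fun r ↦ ?_) fun g ↦ ?_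
    · simp [iterateFrobenius_def, MonoidAlgebra.single_pow]
    · simp [iterateFrobenius_def, MonoidAlgebra.single_pow, hpow]
  exact DFunLike.congr_fun hfrob x

variable [Fintype H] [DecidableEq H] {G : SimpleGraph H} [DecidableRel G.Adj]

theorem adjMatrix_eq_leftMulMatrix (R : Type*) [CommRing R] [Group H]
    (hG : ∀ g x y, G.Adj (x * g) (y * g) ↔ G.Adj x y) :
    G.adjMatrix R = Algebra.leftMulMatrix (MonoidAlgebra.basis H R)
      (∑ s with G.Adj 1 s, MonoidAlgebra.single s 1) := by
  ext x y
  have hadj : G.Adj 1 (x * y⁻¹) ↔ G.Adj x y := by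
    rw [← hG y, one_mul, inv_mul_cancel_right, G.adj_comm]
  have hentry (s : H) : (MonoidAlgebra.basis H R).repr
      (MonoidAlgebra.single s 1 * MonoidAlgebra.basis H R y) x = if s = x * y⁻¹ then 1 else 0 := by
    rw [MonoidAlgebra.basis_apply, MonoidAlgebra.single_mul_single, one_mul,
      ← MonoidAlgebra.basis_apply, Module.Basis.repr_self, Finsupp.single_apply]
    simp only [eq_mul_inv_iff_mul_eq]
  simp [Algebra.leftMulMatrix_eq_repr_mul, Finset.sum_mul, -MonoidAlgebra.basis_apply, hentry, hadj,
    adjMatrix_apply]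

theorem adjMatrix_zmod_pow_eq_self [CommGroup H] {p : ℕ} [Fact p.Prime]
    (hp : p.Coprime (Nat.card H)) (hG : ∀ g x y, G.Adj (g * x) (g * y) ↔ G.Adj x y) :
    G.adjMatrix (ZMod p) ^ p ^ (Nat.card H).totient = G.adjMatrix (ZMod p) := by
  rw [adjMatrix_eq_leftMulMatrix (ZMod p) (by simpa only [mul_comm] using hG), ← map_pow,
    monoidAlgebra_zmod_pow_eq_self hp]

end Cayley

theorem theorem1p3_general {H : Type*} [CommGroup H] (hodd : Odd (Nat.card H))
    {G : SimpleGraph H} (hG : ∀ g x y, G.Adj (g * x) (g * y) ↔ G.Adj x y)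
    (hconn : G.Connected) (hunst : G.IsUnstable) : G.HasTwins := by
  classical
  have := Nat.finite_of_card_ne_zero hodd.pos.ne'
  have := Fintype.ofFinite H
  have hpow : 2 * 2 ^ ((Nat.card H).totient - 1) = 2 ^ (Nat.card H).totient :=
    mul_pow_sub_one (Nat.totient_pos.2 hodd.pos).ne' 2
  have hA : G.adjMatrix (ZMod 2) ^ (2 * 2 ^ ((Nat.card H).totient - 1)) =
      G.adjMatrix (ZMod 2) := by
    rw [hpow, adjMatrix_zmod_pow_eq_self (Nat.coprime_two_left.2 hodd) hG]
  by_contra htwin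
  exact hunst (isStable_of_adjMatrix_pow_two_mul_eq hA hconn htwin)

theorem theorem1p3 {H : Type*} [CommGroup H] [Finite H] (hodd : Odd (Nat.card H))
    (S : Set H) (hone : (1 : H) ∉ S) (hinv : ∀ x ∈ S, x⁻¹ ∈ S)
    (hconn : (SimpleGraph.mulCayley S).Connected)
    (hunst : (SimpleGraph.mulCayley S).IsUnstable) :
    (SimpleGraph.mulCayley S).HasTwins :=
  theorem1p3_general hodd (fun _ _ _ ↦ SimpleGraph.mulCayley_adj_mul_iff_right) hconn hunst
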